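/- Let $\beta\in(0,2)$. Let $\Delta u(x)=u(x+1)-2u(x)+u(x-1)$ be the discrete Laplacian on $\mathbb Z$, let $e^{t\Delta}u(x)=\sum_{n\ge 0}\frac{t^n}{n!}(\Delta^n u)(x)$, and let $$\mathcal L_\beta u(x):=-(-\Delta)^{\beta/2}u(x)=\frac{1}{\Gamma(-\beta/2)}\int_0^\infty \bigl(u-e^{t\Delta}u\bigr)(x)\,\frac{dt}{t^{1+\beta/2}},\qquad x\in\mathbb Z .$$ Put $k_\beta(0)=0$ and $k_\beta(j)=(\mathcal L_\beta \mathbf 1_{\{j\}})(0)$ for $j\neq 0$. For $x\in\mathbb Z$ call $u:\mathbb Z\to\mathbb R$ admissible at $x$ if $\sum_{j}k_\beta(j)|u(x+j)|<\infty$. Then $k_\beta$ is nonnegative, summable, symmetric and not identically zero, and for every $x$ and every $u$ admissible at $x$ the exponential series of $e^{t\Delta}u(x)$ (for every real $t$) and the integral defining $\mathcal L_\beta u(x)$ converge absolutely, and $$\mathcal L_\beta u(x)=\sum_{j\in\mathbb Z}k_\beta(j)\bigl(u(x+j)-u(x)\bigr),$$ the sum being absolutely convergent. Moreover, for no finite $d>0$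 does $\mathcal L_\beta$ satisfy the Bakry-Émery inequality $CD(0,d)$; that is, for no $d\in(0,\infty)$ does $$\Gamma_2(u)(x)\ \ge\ \frac1d\,\bigl(\mathcal L_\beta u(x)\bigr)^2$$ hold for all $x\in\mathbb Z$ and all $u$ admissible at $x$, where $$\Gamma_2(u)(x)=\frac14\sum_{j,l\in\mathbb Z}k_\beta(j)k_\beta(l)\bigl(u(x+j+l)-u(x+j)-u(x+l)+u(x)\bigr)^2\in[0,\infty].$$ -/

import Mathlib

open MeasureTheory Set

noncomputable section

namespace LatticeCD

/-- The discrete Laplacian `Δ u (x) = u (x + 1) - 2 u (x) + u (x - 1)` on `ℤ`. -/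
def laplacian (u : ℤ → ℝ) (x : ℤ) : ℝ :=
  u (x + 1) - 2 * u x + u (x - 1)

/-- The heat semigroup `e^{tΔ}`, as the exponential series `∑ₙ tⁿ / n! · Δⁿ u` evaluated at `x`.
The series converges absolutely for every `u` of at most exponential growth. -/
def heat (t : ℝ) (u : ℤ → ℝ) (x : ℤ) : ℝ :=
  ∑' n : ℕ, t ^ n / (n.factorial : ℝ) * (laplacian^[n] u) x

/-- The integrand `(u - e^{tΔ} u)(x) / t^{1 + β/2}` of the semigroup formula. -/
def fracIntegrand (β : ℝ) (u : ℤ → ℝ) (x : ℤ) (t : ℝ) : ℝ :=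
  (u x - heat t u x) / t ^ (1 + β / 2)

/-- The operator `-(-Δ)^{β/2}`, defined by the semigroup method:
`Γ(-β/2)⁻¹ ∫₀^∞ (u - e^{tΔ} u)(x) t^{-1-β/2} dt`. -/
def fracLaplacian (β : ℝ) (u : ℤ → ℝ) (x : ℤ) : ℝ :=
  1 / Real.Gamma (-(β / 2)) * ∫ t in Ioi (0 : ℝ), fracIntegrand β u x t

/-- The jump kernel of an operator `L` on functions on `ℤ`: its off-diagonal matrix entries
`k j = (L 1_{j})(0)` for `j ≠ 0`, and `k 0 = 0`. For an operator of the form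
`L u (x) = ∑ⱼ k j (u (x + j) - u x)` with `k 0 = 0` it is the kernel `k`. -/
def kernel (L : (ℤ → ℝ) → ℤ → ℝ) (j : ℤ) : ℝ :=
  if j = 0 then 0 else L (Pi.single j 1) 0

/-- The standing conditions on a kernel: nonnegative, summable, symmetric, zero at `0`, and
nontrivial. -/
structure IsJumpKernel (k : ℤ → ℝ) : Prop where
  nonneg : ∀ j, 0 ≤ k j
  summable : Summable k
  symm : ∀ j, k (-j) = k j
  zero : k 0 = 0
  pos : 0 < ∑' j, k j

/-- Membership of `v` in the weighted space `l_{p,k}(ℤ)`. -/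
def MemWeighted (p : ℕ) (k : ℤ → ℝ) (v : ℤ → ℝ) : Prop :=
  Summable fun j => k j * |v j| ^ p

/-- Admissibility of `u` for `CD(κ, d)` at `x`: `u(· + x)` lies in `l_{1,k}` if `κ = 0`, and in
`l_{2,k}` otherwise. -/
def Admissible (κ : ℝ) (k : ℤ → ℝ) (x : ℤ) (u : ℤ → ℝ) : Prop :=
  (κ = 0 → MemWeighted 1 k fun j => u (j + x)) ∧ (κ ≠ 0 → MemWeighted 2 k fun j => u (j + x))

/-- The carré du champ `Γ(u)(x) = ½ ∑ⱼ k j (u (x + j) - u x)²`. -/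
def carreDuChamp (k : ℤ → ℝ) (u : ℤ → ℝ) (x : ℤ) : ℝ :=
  1 / 2 * ∑' j : ℤ, k j * (u (x + j) - u x) ^ 2

/-- The iterated carré du champ
`Γ₂(u)(x) = ¼ ∑_{j,l} k j k l (u (x + j + l) - u (x + j) - u (x + l) + u x)²`, with values in
`[0, ∞]`, since it may be infinite for an admissible `u`. -/
def carreDuChamp₂ (k : ℤ → ℝ) (u : ℤ → ℝ) (x : ℤ) : ENNReal :=
  1 / 4 * ∑' p : ℤ × ℤ, ENNReal.ofReal
    (k p.1 * k p.2 * (u (x + p.1 + p.2) - u (x + p.1) - u (x + p.2) + u x) ^ 2)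

/-- The Bakry-Émery inequality `Γ₂(u)(x) ≥ (1/d) (L u (x))² + κ Γ(u)(x)` for every `u` that is
admissible at `x`. (If `κ ≠ 0` then `Γ(u)(x)` is finite for such `u`.) -/
def CDAt (L : (ℤ → ℝ) → ℤ → ℝ) (κ d : ℝ) (x : ℤ) : Prop :=
  ∀ u : ℤ → ℝ, Admissible κ (kernel L) x u →
    ((1 / d * (L u x) ^ 2 + κ * carreDuChamp (kernel L) u x : ℝ) : EReal) ≤
      (carreDuChamp₂ (kernel L) u x : EReal)

/-- The curvature-dimension inequality `CD(κ, d)`: it holds at every point of `ℤ`. -/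
def CD (L : (ℤ → ℝ) → ℤ → ℝ) (κ d : ℝ) : Prop :=
  ∀ x : ℤ, CDAt L κ d x

end LatticeCD

end

/-!
Let `S` be the unit translation of `ℤ`. Since `Δ = S + S⁻¹ - 2`, the exponential series of `e^{tΔ}`
is a Cauchy product, and `e^{tΔ} u (x)` is the mean of `u (x + a - b)` over two independent Poisson
variables `a`, `b` of mean `t`, as soon as `u` grows at most exponentially
(`ExpGrowth.hasSum_heat`). Hence `e^{tΔ}` is convolution with a symmetric probability kernel, the
kernel of `-(-Δ)^{β/2}` is a positive multiple of the integral of `t ^ (-1 - β/2)` against it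
(`kernel_of_ne`), and the representation of the operator by jumps is Fubini's theorem
(`Admissible.hasSum_fracLaplacian`). Fubini needs nothing but admissibility, except that an
admissible `u` must first be seen to grow at most exponentially; for this an exponential lower bound
of the kernel is enough (`exp_le_kernel`).

For the failure of `CD(0, d)` no asymptotics of the kernel are needed: the argument takes place on
the Fourier side. Let `ψ(θ) = ∑ⱼ k j (1 - cos (θ j))`. As `cos (θ ·)` is an eigenfunction of `Δ`,
the semigroup formula gives `ψ(θ) = c |e^{iθ} - 1| ^ β` with `c > 0` (`exists_hasSum_symbol`). The
second difference of `e^{iθ·}` is `(e^{iθj} - 1) (e^{iθl} - 1)`, so that for `u = ∑ᵢ aᵢ cos (θᵢ ·)` the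
double sum over the kernel factorizes and
`Γ₂(u)(0) ≤ ¼ ∑_{i,i'} aᵢ aᵢ' (ψ(θᵢ) + ψ(θᵢ') - ψ(θᵢ - θᵢ'))²` (`carreDuChamp₂_cos_le`).
Now let `aᵢ = 1 / ψ(θᵢ)` for `N` frequencies. Then `L u (0) = -N`, the diagonal terms contribute a
multiple of `N` to `Γ₂(u)(0)`, and the term of a pair with `r = |e^{iθᵢ'} - 1| / |e^{iθᵢ} - 1| ≤ 1`
is at most `16 r ^ min β (2 - β)` (`interaction_le_of_le`), which is negligible if the frequencies
are lacunary (`exists_lacunary`). Thus `Γ₂(u)(0) ≤ 8 N` while `(L u (0))² = N²`, and `N` is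
arbitrary.
-/

namespace LatticeCD

/-! ### The heat semigroup as a double Poisson average -/

/-- Exponential growth of `u` around `x`, in the form in which it is used: `a` steps to the right
and `b` steps to the left of `x` cost at most a factor `R ^ a * R ^ b`. -/
def ExpGrowth (u : ℤ → ℝ) (x : ℤ) : Prop :=
  ∃ C R : ℝ, ∀ a b : ℕ, |u (x + (a - b))| ≤ C * (R ^ a * R ^ b)

/-- The probability (for `0 ≤ t`) that two independent Poisson variables of mean `t` take the
values `a` and `b`. -/
noncomputable def poissonPair (t : ℝ) (p : ℕ × ℕ) : ℝ :=
  Real.exp (-2 * t) * (t ^ p.1 / (p.1.factorial : ℝ) * (t ^ p.2 / (p.2.factorial : ℝ)))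

/-- The translation `u ↦ u (· + c)` as a linear operator. -/
def shift (c : ℤ) : Module.End ℝ (ℤ → ℝ) :=
  LinearMap.funLeft ℝ ℝ fun x => x + c

lemma shift_apply (c : ℤ) (u : ℤ → ℝ) (x : ℤ) : shift c u x = u (x + c) := rfl

lemma shift_mul (c d : ℤ) : shift c * shift d = shift (c + d) := by
  ext u x
  simp [shift_apply, Module.End.mul_apply, add_assoc]

lemma shift_pow (c : ℤ) (n : ℕ) : shift c ^ n = shift (n * c) := by
  induction n with
  | zero => ext u x; simp [shift_apply]
  | succ n ih => rw [pow_succ, ih, shift_mul]; congr 1; push_cast; ring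

lemma laplacian_iterate (n : ℕ) (u : ℤ → ℝ) :
    laplacian^[n] u = ((shift 1 + shift (-1) + (-2 : ℝ) • 1) ^ n : Module.End ℝ (ℤ → ℝ)) u := by
  induction n with
  | zero => rfl
  | succ n ih =>
    rw [Function.iterate_succ_apply', ih, pow_succ', Module.End.mul_apply]
    ext x
    simp [laplacian, shift_apply, ← sub_eq_add_neg]
    ring

/-- The binomial theorem for commuting elements, in the normalization of the exponential series. -/
lemma pow_div_factorial_add {A : Type*} [Ring A] [Algebra ℝ A] {x y : A} (h : Commute x y)
    (n : ℕ) : ((n.factorial : ℝ)⁻¹) • (x + y) ^ n =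
      ∑ p ∈ Finset.HasAntidiagonal.antidiagonal n,
        (((p.1.factorial : ℝ)⁻¹) • x ^ p.1) * (((p.2.factorial : ℝ)⁻¹) • y ^ p.2) := by
  rw [h.add_pow', Finset.smul_sum]
  refine Finset.sum_congr rfl fun p hp => ?_
  rw [Finset.HasAntidiagonal.mem_antidiagonal] at hp
  rw [← Nat.cast_smul_eq_nsmul ℝ, smul_smul, smul_mul_smul_comm, ← hp, Nat.choose_symm_add,
    Nat.add_choose,
    Nat.cast_div (Nat.factorial_mul_factorial_dvd_factorial_add _ _) (by positivity)]
  congr 1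
  push_cast
  field_simp

/-- Evaluated at a point, the exponential series of a sum of commuting operators is a Cauchy
product. -/
lemma exp_term_add {A B : Module.End ℝ (ℤ → ℝ)} (h : Commute A B) (t : ℝ) (u : ℤ → ℝ) (x : ℤ)
    (n : ℕ) : t ^ n / (n.factorial : ℝ) * (((A + B) ^ n) u) x =
      ∑ p ∈ Finset.HasAntidiagonal.antidiagonal n, t ^ p.1 / (p.1.factorial : ℝ) *
        (t ^ p.2 / (p.2.factorial : ℝ)) * ((A ^ p.1 * B ^ p.2) u) x := by
  have := congrFun (congrArg (fun D : Module.End ℝ (ℤ → ℝ) => D u) (pow_div_factorial_add h n)) x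
  simp only [LinearMap.smul_apply, Pi.smul_apply, smul_eq_mul, LinearMap.sum_apply,
    Finset.sum_apply, smul_mul_smul_comm] at this
  rw [div_eq_mul_inv, mul_assoc, this, Finset.mul_sum]
  refine Finset.sum_congr rfl fun p hp => ?_
  rw [Finset.HasAntidiagonal.mem_antidiagonal] at hp
  rw [← hp, pow_add]
  ring

lemma exp_term_shift (t : ℝ) (u : ℤ → ℝ) (x : ℤ) (n : ℕ) :
    t ^ n / (n.factorial : ℝ) * (((shift 1 + shift (-1)) ^ n) u) x =
      ∑ p ∈ Finset.HasAntidiagonal.antidiagonal n, t ^ p.1 / (p.1.factorial : ℝ) *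
        (t ^ p.2 / (p.2.factorial : ℝ)) * u (x + (p.1 - p.2)) := by
  have h : Commute (shift 1) (shift (-1)) := by
    rw [commute_iff_eq, shift_mul, shift_mul, add_comm]
  rw [exp_term_add h]
  refine Finset.sum_congr rfl fun p _ => ?_
  rw [shift_pow, shift_pow, shift_mul, shift_apply]
  congr 3
  ring

lemma exp_term_laplacian (t : ℝ) (u : ℤ → ℝ) (x : ℤ) (n : ℕ) :
    t ^ n / (n.factorial : ℝ) * (laplacian^[n] u) x =
      ∑ p ∈ Finset.HasAntidiagonal.antidiagonal n,
        (t ^ p.1 / (p.1.factorial : ℝ) * (((shift 1 + shift (-1)) ^ p.1) u) x) *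
          ((-2 * t) ^ p.2 / (p.2.factorial : ℝ)) := by
  have h : Commute (shift 1 + shift (-1)) ((-2 : ℝ) • (1 : Module.End ℝ (ℤ → ℝ))) :=
    (Commute.one_right _).smul_right _
  rw [laplacian_iterate, exp_term_add h]
  refine Finset.sum_congr rfl fun p _ => ?_
  rw [smul_pow, one_pow, mul_smul_comm, mul_one, LinearMap.smul_apply, Pi.smul_apply, smul_eq_mul,
    mul_pow]
  ring

lemma summable_pow_div_factorial_prod (y : ℝ) :
    Summable fun p : ℕ × ℕ => y ^ p.1 / (p.1.factorial : ℝ) * (y ^ p.2 / (p.2.factorial : ℝ)) :=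
  summable_mul_of_summable_norm (Real.summable_pow_div_factorial y).norm
    (Real.summable_pow_div_factorial y).norm

lemma ExpGrowth.summable_prod {u : ℤ → ℝ} {x : ℤ} (hu : ExpGrowth u x) (t : ℝ) :
    Summable fun p : ℕ × ℕ => t ^ p.1 / (p.1.factorial : ℝ) * (t ^ p.2 / (p.2.factorial : ℝ)) *
      u (x + (p.1 - p.2)) := by
  obtain ⟨C, R, h⟩ := hu
  refine Summable.of_norm_bounded ((summable_pow_div_factorial_prod (|t| * R)).mul_left C)
    fun p => ?_
  rw [norm_mul, norm_mul, norm_div, norm_div, norm_pow, norm_pow, Real.norm_natCast,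
    Real.norm_natCast, Real.norm_eq_abs, Real.norm_eq_abs]
  calc |t| ^ p.1 / (p.1.factorial : ℝ) * (|t| ^ p.2 / (p.2.factorial : ℝ)) *
        |u (x + (p.1 - p.2))|
      ≤ |t| ^ p.1 / (p.1.factorial : ℝ) * (|t| ^ p.2 / (p.2.factorial : ℝ)) *
        (C * (R ^ p.1 * R ^ p.2)) := by gcongr; exact h _ _
    _ = _ := by rw [mul_pow, mul_pow]; ring

/-- Summation of an absolutely convergent double series along antidiagonals. -/
lemma hasSum_antidiagonal {f : ℕ × ℕ → ℝ} (hf : Summable f) :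
    HasSum (fun n => ∑ p ∈ Finset.HasAntidiagonal.antidiagonal n, f p) (∑' p, f p) := by
  have h := (Finset.HasAntidiagonal.sigmaAntidiagonalEquivProd (A := ℕ)).hasSum_iff.2 hf.hasSum
  refine h.sigma fun n => ?_
  rw [← Finset.sum_coe_sort]
  exact hasSum_fintype _

lemma summable_norm_antidiagonal {f : ℕ × ℕ → ℝ} (hf : Summable f) :
    Summable fun n => ‖∑ p ∈ Finset.HasAntidiagonal.antidiagonal n, f p‖ :=
  Summable.of_nonneg_of_le (fun _ => norm_nonneg _) (fun _ => norm_sum_le _ _)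
    (hasSum_antidiagonal hf.norm).summable

/-- The exponential series of `e^{tΔ}` is the Cauchy product of the series of `e^{t(S + S⁻¹)}`,
`S` the unit translation, and of `e^{-2t}`. -/
lemma ExpGrowth.hasSum_heat {u : ℤ → ℝ} {x : ℤ} (hu : ExpGrowth u x) (t : ℝ) :
    HasSum (fun n : ℕ => t ^ n / (n.factorial : ℝ) * (laplacian^[n] u) x)
      (∑' p : ℕ × ℕ, poissonPair t p * u (x + (p.1 - p.2))) := by
  have h1 := hasSum_antidiagonal (hu.summable_prod t)
  have h1' := summable_norm_antidiagonal (hu.summable_prod t)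
  simp_rw [← exp_term_shift] at h1 h1'
  have h2 := Real.summable_pow_div_factorial (-2 * t)
  have h3 : Real.exp (-2 * t) = ∑' n : ℕ, (-2 * t) ^ n / (n.factorial : ℝ) := by
    rw [Real.exp_eq_exp_ℝ, NormedSpace.exp_eq_tsum_div]
  have h4 := tsum_mul_tsum_eq_tsum_sum_antidiagonal_of_summable_norm h1' h2.norm
  have h5 := (summable_norm_sum_mul_antidiagonal_of_summable_norm h1' h2.norm).of_norm
  simp_rw [← exp_term_laplacian] at h4 h5
  have h6 : ∑' p : ℕ × ℕ, poissonPair t p * u (x + (p.1 - p.2)) =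
      ∑' n : ℕ, t ^ n / (n.factorial : ℝ) * (laplacian^[n] u) x := by
    rw [← h4, h1.tsum_eq, ← h3, mul_comm, ← tsum_mul_left]
    refine tsum_congr fun p => ?_
    rw [poissonPair]
    ring
  rw [h6]
  exact h5.hasSum

lemma ExpGrowth.heat_eq {u : ℤ → ℝ} {x : ℤ} (hu : ExpGrowth u x) (t : ℝ) :
    heat t u x = ∑' p : ℕ × ℕ, poissonPair t p * u (x + (p.1 - p.2)) :=
  (hu.hasSum_heat t).tsum_eq

lemma ExpGrowth.summable_poissonPair {u : ℤ → ℝ} {x : ℤ} (hu : ExpGrowth u x) (t : ℝ) :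
    Summable fun p : ℕ × ℕ => poissonPair t p * u (x + (p.1 - p.2)) := by
  refine ((hu.summable_prod t).mul_left (Real.exp (-2 * t))).congr fun p => ?_
  rw [poissonPair]
  ring

lemma ExpGrowth.measurable_heat {u : ℤ → ℝ} {x : ℤ} (hu : ExpGrowth u x) :
    Measurable fun t => heat t u x := by
  refine measurable_of_tendsto_metrizable (f := fun N t => ∑ n ∈ Finset.range N,
    t ^ n / (n.factorial : ℝ) * (laplacian^[n] u) x) (fun N => by fun_prop) ?_
  rw [tendsto_pi_nhds]
  intro t
  rw [hu.heat_eq]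
  exact (hu.hasSum_heat t).tendsto_sum_nat

lemma ExpGrowth.of_bounded {u : ℤ → ℝ} {C : ℝ} (h : ∀ j, |u j| ≤ C) (x : ℤ) : ExpGrowth u x :=
  ⟨C, 1, fun a b => by simpa using h _⟩

/-! ### The heat kernel -/

lemma laplacian_iterate_cos (θ : ℝ) (n : ℕ) :
    laplacian^[n] (fun y : ℤ => Real.cos (θ * y)) =
      fun y : ℤ => (-(2 - 2 * Real.cos θ)) ^ n * Real.cos (θ * y) := by
  induction n with
  | zero => simp
  | succ n ih =>
    rw [Function.iterate_succ_apply', ih]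
    ext x
    simp only [laplacian]
    push_cast
    rw [show θ * ((x : ℝ) + 1) = θ * x + θ by ring, show θ * ((x : ℝ) - 1) = θ * x - θ by ring,
      Real.cos_add, Real.cos_sub]
    ring

/-- `cos (θ ·)` is an eigenfunction of `e^{tΔ}`. -/
lemma heat_cos (θ t : ℝ) (x : ℤ) :
    heat t (fun y : ℤ => Real.cos (θ * y)) x =
      Real.exp (-(2 - 2 * Real.cos θ) * t) * Real.cos (θ * x) := by
  rw [heat, Real.exp_eq_exp_ℝ, NormedSpace.exp_eq_tsum_div, ← tsum_mul_right]
  refine tsum_congr fun n => ?_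
  rw [laplacian_iterate_cos, mul_pow]
  ring

/-- The heat kernel of `Δ`, that is the matrix entry `(e^{tΔ} 1_{j})(0)`. -/
noncomputable def heatKernel (t : ℝ) (j : ℤ) : ℝ := heat t (Pi.single j 1) 0

lemma expGrowth_single (j : ℤ) : ExpGrowth (Pi.single j 1) 0 := by
  refine ExpGrowth.of_bounded (C := 1) (fun i => ?_) 0
  rw [Pi.single_apply]
  split_ifs <;> simp

lemma hasSum_heatKernel (t : ℝ) (j : ℤ) :
    HasSum (fun p : ℕ × ℕ => poissonPair t p * (Pi.single j 1 : ℤ → ℝ) (p.1 - p.2))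
      (heatKernel t j) := by
  have h := ((expGrowth_single j).summable_poissonPair t).hasSum
  rw [← (expGrowth_single j).heat_eq] at h
  simpa only [zero_add, heatKernel] using h

lemma measurable_heatKernel (j : ℤ) : Measurable fun t => heatKernel t j :=
  (expGrowth_single j).measurable_heat

lemma poissonPair_nonneg {t : ℝ} (ht : 0 ≤ t) (p : ℕ × ℕ) : 0 ≤ poissonPair t p := by
  rw [poissonPair]
  positivity

lemma single_one_nonneg (j i : ℤ) : 0 ≤ (Pi.single j 1 : ℤ → ℝ) i := by
  rw [Pi.single_apply]
  split_ifs <;> simp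

lemma heatKernel_nonneg {t : ℝ} (ht : 0 ≤ t) (j : ℤ) : 0 ≤ heatKernel t j :=
  (hasSum_heatKernel t j).nonneg fun p => mul_nonneg (poissonPair_nonneg ht p)
    (single_one_nonneg _ _)

lemma heatKernel_neg (t : ℝ) (j : ℤ) : heatKernel t (-j) = heatKernel t j := by
  rw [← (hasSum_heatKernel t (-j)).tsum_eq, ← (hasSum_heatKernel t j).tsum_eq,
    ← (Equiv.prodComm ℕ ℕ).tsum_eq]
  refine tsum_congr fun p => ?_
  have h : ((p.2 : ℤ) - p.1 = -j) ↔ ((p.1 : ℤ) - p.2 = j) := by omega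
  simp only [Equiv.prodComm_apply, Prod.fst_swap, Prod.snd_swap, Pi.single_apply, h, poissonPair]
  split_ifs <;> ring

/-- The contribution to the heat kernel at `a` of `a` steps to the right and none to the left. -/
lemma exp_mul_pow_le_heatKernel {t : ℝ} (ht : 0 ≤ t) (a : ℕ) :
    Real.exp (-2 * t) * (t ^ a / (a.factorial : ℝ)) ≤ heatKernel t a := by
  have h := le_hasSum (hasSum_heatKernel t a) (a, 0) fun p _ =>
    mul_nonneg (poissonPair_nonneg ht p) (single_one_nonneg _ _)
  simpa [poissonPair] using h

/-- `e^{tΔ}` is convolution with the heat kernel. -/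
lemma ExpGrowth.hasSum_heatKernel_mul {u : ℤ → ℝ} {x : ℤ} (hu : ExpGrowth u x) (t : ℝ) :
    HasSum (fun j : ℤ => heatKernel t j * u (x + j)) (heat t u x) := by
  have h := (hu.summable_poissonPair t).hasSum.tsum_fiberwise
    (fun p : ℕ × ℕ => (p.1 : ℤ) - p.2)
  rw [← hu.heat_eq] at h
  refine h.congr_fun fun j => ?_
  rw [← (hasSum_heatKernel t j).tsum_eq, ← tsum_mul_right,
    tsum_subtype ((fun p : ℕ × ℕ => (p.1 : ℤ) - p.2) ⁻¹' {j})
      fun p => poissonPair t p * u (x + (p.1 - p.2))]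
  refine tsum_congr fun p => ?_
  by_cases hp : (p.1 : ℤ) - p.2 = j <;> simp [Set.indicator, hp]

lemma hasSum_heatKernel_one (t : ℝ) : HasSum (heatKernel t) 1 := by
  have h := (ExpGrowth.of_bounded (u := fun y : ℤ => Real.cos (0 * y)) (C := 1)
    (fun _ => Real.abs_cos_le_one _) 0).hasSum_heatKernel_mul t
  rw [heat_cos] at h
  simpa using h

/-- Away from `0` the heat kernel has at most the mass `1 - e^{-2t}` of the paths that jump. -/
lemma sum_heatKernel_le {t : ℝ} (ht : 0 ≤ t) {s : Finset ℤ} (hs : (0 : ℤ) ∉ s) :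
    ∑ j ∈ s, heatKernel t j ≤ 1 - Real.exp (-2 * t) := by
  have h := sum_le_hasSum (insert 0 s) (fun j _ => heatKernel_nonneg ht j)
    (hasSum_heatKernel_one t)
  rw [Finset.sum_insert hs] at h
  have h0 := exp_mul_pow_le_heatKernel ht 0
  simp only [pow_zero, Nat.factorial_zero, Nat.cast_one, div_one, mul_one, Nat.cast_zero] at h0
  linarith

lemma heatKernel_le {t : ℝ} (ht : 0 ≤ t) {j : ℤ} (hj : j ≠ 0) :
    heatKernel t j ≤ 1 - Real.exp (-2 * t) := by
  simpa using sum_heatKernel_le ht (s := {j}) (by simpa using hj.symm)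

/-! ### Integrals against `t ^ (-1 - β / 2)` -/

section

variable {β : ℝ}

lemma integrableOn_one_sub_exp (hβ₀ : 0 < β) (hβ₂ : β < 2) {c : ℝ} (hc : 0 ≤ c) :
    IntegrableOn (fun t : ℝ => (1 - Real.exp (-c * t)) / t ^ (1 + β / 2)) (Ioi 0) := by
  have hm : Measurable fun t : ℝ => (1 - Real.exp (-c * t)) / t ^ (1 + β / 2) := by fun_prop
  have hnn : ∀ t : ℝ, 0 < t → 0 ≤ 1 - Real.exp (-c * t) := fun t ht => by
    rw [sub_nonneg, Real.exp_le_one_iff]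
    nlinarith
  rw [← Ioc_union_Ioi_eq_Ioi zero_le_one]
  refine IntegrableOn.union ?_ ?_
  · have h : IntegrableOn (fun t : ℝ => c * t ^ (-(β / 2))) (Ioc 0 1) :=
      ((intervalIntegrable_iff_integrableOn_Ioc_of_le zero_le_one).1
        (intervalIntegral.intervalIntegrable_rpow' (by linarith))).const_mul c
    refine Integrable.mono' h hm.aestronglyMeasurable ?_
    filter_upwards [ae_restrict_mem measurableSet_Ioc] with t ht
    have ht0 : 0 < t := ht.1
    rw [Real.norm_of_nonneg (div_nonneg (hnn t ht0) (by positivity)), div_le_iff₀ (by positivity),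
      mul_assoc, ← Real.rpow_add ht0]
    have := Real.add_one_le_exp (-c * t)
    rw [show -(β / 2) + (1 + β / 2) = 1 by ring, Real.rpow_one]
    linarith
  · refine Integrable.mono' (integrableOn_Ioi_rpow_of_lt (a := -(1 + β / 2)) (by linarith)
      zero_lt_one) hm.aestronglyMeasurable ?_
    filter_upwards [ae_restrict_mem measurableSet_Ioi] with t ht
    have ht0 : 0 < t := zero_lt_one.trans ht
    rw [Real.norm_of_nonneg (div_nonneg (hnn t ht0) (by positivity)), Real.rpow_neg ht0.le,
      div_eq_mul_inv]
    refine mul_le_of_le_one_left (by positivity) ?_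
    have := Real.exp_pos (-c * t)
    linarith

/-- The substitution `t ↦ c t`. -/
lemma integral_one_sub_exp (hβ₀ : 0 < β) {c : ℝ} (hc : 0 ≤ c) :
    ∫ t in Ioi (0 : ℝ), (1 - Real.exp (-c * t)) / t ^ (1 + β / 2) =
      c ^ (β / 2) * ∫ t in Ioi (0 : ℝ), (1 - Real.exp (-t)) / t ^ (1 + β / 2) := by
  rcases hc.eq_or_lt with rfl | hc
  · rw [Real.zero_rpow (by positivity)]
    simp
  have h := integral_comp_mul_left_Ioi
    (fun t : ℝ => (1 - Real.exp (-t)) / t ^ (1 + β / 2)) 0 hc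
  rw [mul_zero, smul_eq_mul, inv_mul_eq_div, eq_div_iff hc.ne'] at h
  rw [← h, mul_comm _ c, ← mul_assoc, ← integral_const_mul]
  refine setIntegral_congr_fun measurableSet_Ioi fun t ht => ?_
  have ht0 : (0 : ℝ) < t := ht
  rw [Real.mul_rpow hc.le ht0.le, Real.rpow_add hc, Real.rpow_one, neg_mul]
  have : 0 < c ^ (β / 2) := by positivity
  have : 0 < t ^ (1 + β / 2) := by positivity
  field_simp

lemma integral_one_sub_exp_pos (hβ₀ : 0 < β) (hβ₂ : β < 2) :
    0 < ∫ t in Ioi (0 : ℝ), (1 - Real.exp (-t)) / t ^ (1 + β / 2) := by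
  have hpos : ∀ t ∈ Ioi (0 : ℝ), 0 < (1 - Real.exp (-t)) / t ^ (1 + β / 2) := fun t ht => by
    have ht0 : (0 : ℝ) < t := ht
    have : Real.exp (-t) < 1 := by rw [Real.exp_lt_one_iff]; linarith
    have : 0 < 1 - Real.exp (-t) := by linarith
    positivity
  have hint := integrableOn_one_sub_exp hβ₀ hβ₂ zero_le_one
  simp only [neg_mul, one_mul] at hint
  rw [setIntegral_pos_iff_support_of_nonneg_ae _ hint]
  · rw [inter_eq_right.2 fun t ht => Function.mem_support.2 (hpos t ht).ne']
    simp
  · filter_upwards [ae_restrict_mem measurableSet_Ioi] with t ht using (hpos t ht).le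

lemma integrableOn_heatKernel (hβ₀ : 0 < β) (hβ₂ : β < 2) {j : ℤ} (hj : j ≠ 0) :
    IntegrableOn (fun t => heatKernel t j / t ^ (1 + β / 2)) (Ioi 0) := by
  refine Integrable.mono' (integrableOn_one_sub_exp hβ₀ hβ₂ zero_le_two)
    ((measurable_heatKernel j).div (by fun_prop)).aestronglyMeasurable ?_
  filter_upwards [ae_restrict_mem measurableSet_Ioi] with t ht
  have ht0 : (0 : ℝ) < t := ht
  have := heatKernel_nonneg ht0.le j
  rw [Real.norm_of_nonneg (by positivity)]
  gcongr
  exact heatKernel_le ht0.le hj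

lemma Gamma_neg_half_neg (hβ₀ : 0 < β) (hβ₂ : β < 2) : Real.Gamma (-(β / 2)) < 0 := by
  have h := Real.Gamma_add_one (s := -(β / 2)) (by linarith)
  have h1 : 0 < Real.Gamma (-(β / 2) + 1) := Real.Gamma_pos_of_pos (by linarith)
  rw [h] at h1
  nlinarith

/-! ### The jump kernel -/

lemma kernel_zero : kernel (fracLaplacian β) 0 = 0 := by simp [kernel]

lemma kernel_of_ne {j : ℤ} (hj : j ≠ 0) : kernel (fracLaplacian β) j =
    -(1 / Real.Gamma (-(β / 2))) * ∫ t in Ioi (0 : ℝ), heatKernel t j / t ^ (1 + β / 2) := by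
  rw [kernel, if_neg hj, fracLaplacian, neg_mul, ← mul_neg, ← integral_neg]
  congr 2
  ext t
  rw [fracIntegrand, heatKernel, Pi.single_eq_of_ne hj.symm]
  ring

lemma neg_one_div_Gamma_pos (hβ₀ : 0 < β) (hβ₂ : β < 2) : 0 < -(1 / Real.Gamma (-(β / 2))) := by
  rw [neg_pos, one_div_neg]
  exact Gamma_neg_half_neg hβ₀ hβ₂

lemma kernel_nonneg (hβ₀ : 0 < β) (hβ₂ : β < 2) (j : ℤ) : 0 ≤ kernel (fracLaplacian β) j := by
  rcases eq_or_ne j 0 with rfl | hj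
  · exact kernel_zero.ge
  rw [kernel_of_ne hj]
  refine mul_nonneg (neg_one_div_Gamma_pos hβ₀ hβ₂).le
    (setIntegral_nonneg measurableSet_Ioi fun t ht => ?_)
  have ht0 : (0 : ℝ) < t := ht
  have := heatKernel_nonneg ht0.le j
  positivity

lemma kernel_neg (j : ℤ) : kernel (fracLaplacian β) (-j) = kernel (fracLaplacian β) j := by
  rcases eq_or_ne j 0 with rfl | hj
  · simp
  rw [kernel_of_ne hj, kernel_of_ne (neg_ne_zero.2 hj)]
  simp_rw [heatKernel_neg]

lemma summable_kernel (hβ₀ : 0 < β) (hβ₂ : β < 2) : Summable (kernel (fracLaplacian β)) := by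
  refine summable_of_sum_le (kernel_nonneg hβ₀ hβ₂) (c := -(1 / Real.Gamma (-(β / 2))) *
    ∫ t in Ioi (0 : ℝ), (1 - Real.exp (-2 * t)) / t ^ (1 + β / 2)) fun s => ?_
  have h0 : ∀ j ∈ s.erase 0, j ≠ 0 := fun j hj => Finset.ne_of_mem_erase hj
  rw [← Finset.sum_erase s kernel_zero, Finset.sum_congr rfl fun j hj => kernel_of_ne (h0 j hj),
    ← Finset.mul_sum, ← integral_finsetSum _ fun j hj =>
      integrableOn_heatKernel hβ₀ hβ₂ (h0 j hj)]
  refine mul_le_mul_of_nonneg_left ?_ (neg_one_div_Gamma_pos hβ₀ hβ₂).le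
  refine setIntegral_mono_on (integrable_finsetSum _ fun j hj =>
      integrableOn_heatKernel hβ₀ hβ₂ (h0 j hj)) (integrableOn_one_sub_exp hβ₀ hβ₂ zero_le_two)
    measurableSet_Ioi fun t ht => ?_
  have ht0 : (0 : ℝ) < t := ht
  rw [← Finset.sum_div]
  gcongr
  exact sum_heatKernel_le ht0.le (Finset.notMem_erase 0 s)

/-- A crude lower bound for the kernel, from the times `t ∈ (n, n + 1]` alone; it suffices to
confine admissible functions to exponential growth. -/
lemma exp_le_kernel (hβ₀ : 0 < β) (hβ₂ : β < 2) {n : ℕ} (hn : n ≠ 0) :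
    -(1 / Real.Gamma (-(β / 2))) * Real.exp (-2) * Real.exp (-4) ^ n ≤
      kernel (fracLaplacian β) n := by
  have hj : (n : ℤ) ≠ 0 := by exact_mod_cast hn
  rw [kernel_of_ne hj, mul_assoc]
  refine mul_le_mul_of_nonneg_left ?_ (neg_one_div_Gamma_pos hβ₀ hβ₂).le
  have hsub : Ioc (n : ℝ) (n + 1) ⊆ Ioi 0 := fun t ht => (Nat.cast_nonneg n).trans_lt ht.1
  have hint := integrableOn_heatKernel hβ₀ hβ₂ hj
  calc Real.exp (-2) * Real.exp (-4) ^ n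
      = ∫ t in Ioc (n : ℝ) (n + 1), Real.exp (-2) * Real.exp (-4) ^ n := by simp
    _ ≤ ∫ t in Ioc (n : ℝ) (n + 1), heatKernel t n / t ^ (1 + β / 2) := by
        refine setIntegral_mono_on (integrableOn_const measure_Ioc_lt_top.ne) (hint.mono_set hsub)
          measurableSet_Ioc fun t ht => ?_
        have ht0 : 0 < t := hsub ht
        have hn1 : (1 : ℝ) ≤ n := by exact_mod_cast Nat.one_le_iff_ne_zero.2 hn
        rw [le_div_iff₀ (by positivity)]
        have h1 : t ^ (1 + β / 2) ≤ Real.exp n ^ 2 := by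
          calc t ^ (1 + β / 2) ≤ t ^ (2 : ℝ) :=
                Real.rpow_le_rpow_of_exponent_le (hn1.trans ht.1.le) (by linarith)
            _ = t ^ 2 := by exact_mod_cast Real.rpow_natCast t 2
            _ ≤ Real.exp n ^ 2 := by
                gcongr
                exact ht.2.trans (Real.add_one_le_exp _)
        have h2 : 1 ≤ t ^ n / (n.factorial : ℝ) := by
          rw [one_le_div (by positivity)]
          calc (n.factorial : ℝ) ≤ (n : ℝ) ^ n := by exact_mod_cast Nat.factorial_le_pow n
            _ ≤ t ^ n := by gcongr; exact ht.1.le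
        calc Real.exp (-2) * Real.exp (-4) ^ n * t ^ (1 + β / 2)
            ≤ Real.exp (-2) * Real.exp (-4) ^ n * Real.exp n ^ 2 := by gcongr
          _ = Real.exp (-2 * (n + 1)) := by
              rw [← Real.exp_nat_mul, ← Real.exp_nat_mul, ← Real.exp_add, ← Real.exp_add]
              congr 1
              push_cast
              ring
          _ ≤ Real.exp (-2 * t) := by
              have := ht.2
              exact Real.exp_le_exp.2 (by linarith)
          _ ≤ Real.exp (-2 * t) * (t ^ n / (n.factorial : ℝ)) :=
              le_mul_of_one_le_right (Real.exp_pos _).le h2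
          _ ≤ heatKernel t n := exp_mul_pow_le_heatKernel ht0.le n
    _ ≤ ∫ t in Ioi (0 : ℝ), heatKernel t n / t ^ (1 + β / 2) := by
        refine setIntegral_mono_set hint ?_ hsub.eventuallyLE
        filter_upwards [ae_restrict_mem measurableSet_Ioi] with t ht
        have ht0 : (0 : ℝ) < t := ht
        have := heatKernel_nonneg ht0.le n
        show 0 ≤ heatKernel t n / t ^ (1 + β / 2)
        positivity

lemma isJumpKernel (hβ₀ : 0 < β) (hβ₂ : β < 2) : IsJumpKernel (kernel (fracLaplacian β)) where
  nonneg := kernel_nonneg hβ₀ hβ₂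
  summable := summable_kernel hβ₀ hβ₂
  symm := kernel_neg
  zero := kernel_zero
  pos := by
    refine (summable_kernel hβ₀ hβ₂).tsum_pos (kernel_nonneg hβ₀ hβ₂) ((1 : ℕ) : ℤ) ?_
    refine lt_of_lt_of_le ?_ (exp_le_kernel hβ₀ hβ₂ one_ne_zero)
    have := neg_one_div_Gamma_pos hβ₀ hβ₂
    positivity

/-! ### The operator on admissible functions -/

lemma Admissible.summable {x : ℤ} {u : ℤ → ℝ}
    (hu : Admissible 0 (kernel (fracLaplacian β)) x u) :
    Summable fun j => kernel (fracLaplacian β) j * |u (x + j)| := by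
  have h := hu.1 rfl
  simpa only [MemWeighted, pow_one, add_comm _ x] using h

lemma Admissible.expGrowth (hβ₀ : 0 < β) (hβ₂ : β < 2) {x : ℤ} {u : ℤ → ℝ}
    (hu : Admissible 0 (kernel (fracLaplacian β)) x u) : ExpGrowth u x := by
  have hs := hu.summable
  set S := ∑' j, kernel (fracLaplacian β) j * |u (x + j)|
  set c := -(1 / Real.Gamma (-(β / 2))) * Real.exp (-2)
  have hc : 0 < c := mul_pos (neg_one_div_Gamma_pos hβ₀ hβ₂) (Real.exp_pos _)
  have hnn : ∀ j, 0 ≤ kernel (fracLaplacian β) j * |u (x + j)| := fun j =>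
    mul_nonneg (kernel_nonneg hβ₀ hβ₂ j) (abs_nonneg _)
  have hS : 0 ≤ S := tsum_nonneg hnn
  have key : ∀ j : ℤ, |u (x + j)| ≤ (|u x| + S / c) * Real.exp 4 ^ j.natAbs := by
    intro j
    rcases eq_or_ne j 0 with rfl | hj
    · have : 0 ≤ S / c := by positivity
      simpa
    have h1 : kernel (fracLaplacian β) j * |u (x + j)| ≤ S := hs.le_tsum j fun i _ => hnn i
    have h2 : c * Real.exp (-4) ^ j.natAbs ≤ kernel (fracLaplacian β) j := by
      refine (exp_le_kernel hβ₀ hβ₂ (Int.natAbs_ne_zero.2 hj)).trans_eq ?_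
      rcases Int.natAbs_eq j with h | h
      · rw [← h]
      · conv_rhs => rw [h, kernel_neg]
    have h3 : Real.exp 4 ^ j.natAbs * Real.exp (-4) ^ j.natAbs = 1 := by
      rw [← mul_pow, ← Real.exp_add]
      simp
    calc |u (x + j)|
        = c * Real.exp (-4) ^ j.natAbs * |u (x + j)| / c * Real.exp 4 ^ j.natAbs := by
          rw [mul_assoc, mul_div_cancel_left₀ _ hc.ne', mul_right_comm, mul_comm (_ ^ _), h3,
            one_mul]
      _ ≤ S / c * Real.exp 4 ^ j.natAbs := by
          gcongr
          exact (mul_le_mul_of_nonneg_right h2 (abs_nonneg _)).trans h1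
      _ ≤ _ := by
          gcongr
          exact le_add_of_nonneg_left (abs_nonneg _)
  refine ⟨|u x| + S / c, Real.exp 4, fun a b => (key _).trans ?_⟩
  rw [← pow_add]
  gcongr
  · exact Real.one_le_exp (by norm_num)
  · omega

/-- The summand of `u - e^{tΔ} u` that belongs to the jump `j`, divided by `t ^ (1 + β / 2)`. -/
noncomputable def jumpIntegrand (β : ℝ) (u : ℤ → ℝ) (x j : ℤ) (t : ℝ) : ℝ :=
  heatKernel t j * (u x - u (x + j)) / t ^ (1 + β / 2)

lemma hasSum_jumpIntegrand {x : ℤ} {u : ℤ → ℝ} (hu : ExpGrowth u x) (t : ℝ) :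
    HasSum (fun j => jumpIntegrand β u x j t) (fracIntegrand β u x t) := by
  have h := ((hasSum_heatKernel_one t).mul_right (u x)).sub (hu.hasSum_heatKernel_mul t)
  rw [one_mul] at h
  simp_rw [← mul_sub] at h
  exact h.div_const _

lemma jumpIntegrand_eq (u : ℤ → ℝ) (x j : ℤ) (t : ℝ) : jumpIntegrand β u x j t =
    (u x - u (x + j)) * (heatKernel t j / t ^ (1 + β / 2)) := by
  rw [jumpIntegrand]
  ring

lemma integrableOn_jumpIntegrand (hβ₀ : 0 < β) (hβ₂ : β < 2) (u : ℤ → ℝ) (x j : ℤ) :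
    IntegrableOn (jumpIntegrand β u x j) (Ioi 0) := by
  rcases eq_or_ne j 0 with rfl | hj
  · have : jumpIntegrand β u x 0 = fun _ => 0 := by ext t; simp [jumpIntegrand]
    rw [this]
    exact integrableOn_zero
  · have : jumpIntegrand β u x j = fun t => (u x - u (x + j)) *
        (heatKernel t j / t ^ (1 + β / 2)) := by ext t; rw [jumpIntegrand_eq]
    rw [this]
    exact (integrableOn_heatKernel hβ₀ hβ₂ hj).const_mul _

lemma integral_jumpIntegrand (u : ℤ → ℝ) (x j : ℤ) :
    1 / Real.Gamma (-(β / 2)) * ∫ t in Ioi (0 : ℝ), jumpIntegrand β u x j t =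
      kernel (fracLaplacian β) j * (u (x + j) - u x) := by
  rcases eq_or_ne j 0 with rfl | hj
  · simp [jumpIntegrand]
  · simp_rw [jumpIntegrand_eq, integral_const_mul, kernel_of_ne hj]
    ring

lemma integral_norm_jumpIntegrand (u : ℤ → ℝ) (x j : ℤ) :
    -(1 / Real.Gamma (-(β / 2))) * ∫ t in Ioi (0 : ℝ), ‖jumpIntegrand β u x j t‖ =
      kernel (fracLaplacian β) j * |u (x + j) - u x| := by
  rcases eq_or_ne j 0 with rfl | hj
  · simp [jumpIntegrand]
  · rw [kernel_of_ne hj, mul_assoc, ← integral_mul_const]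
    congr 1
    refine setIntegral_congr_fun measurableSet_Ioi fun t ht => ?_
    have ht0 : (0 : ℝ) < t := ht
    have := heatKernel_nonneg ht0.le j
    rw [jumpIntegrand_eq, norm_mul, Real.norm_of_nonneg (by positivity : 0 ≤ heatKernel t j / _),
      Real.norm_eq_abs, abs_sub_comm, mul_comm]

lemma Admissible.summable_integral_norm (hβ₀ : 0 < β) (hβ₂ : β < 2) {x : ℤ} {u : ℤ → ℝ}
    (hu : Admissible 0 (kernel (fracLaplacian β)) x u) :
    Summable fun j => ∫ t in Ioi (0 : ℝ), ‖jumpIntegrand β u x j t‖ := by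
  rw [← summable_mul_left_iff (neg_one_div_Gamma_pos hβ₀ hβ₂).ne']
  simp_rw [integral_norm_jumpIntegrand]
  refine Summable.of_nonneg_of_le (fun j => mul_nonneg (kernel_nonneg hβ₀ hβ₂ j) (abs_nonneg _))
    (fun j => ?_) ((hu.summable).add ((summable_kernel hβ₀ hβ₂).mul_right |u x|))
  rw [← mul_add]
  exact mul_le_mul_of_nonneg_left (abs_sub _ _) (kernel_nonneg hβ₀ hβ₂ j)

lemma Admissible.integrableOn_fracIntegrand (hβ₀ : 0 < β) (hβ₂ : β < 2) {x : ℤ} {u : ℤ → ℝ}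
    (hu : Admissible 0 (kernel (fracLaplacian β)) x u) :
    IntegrableOn (fracIntegrand β u x) (Ioi 0) := by
  have hg := hu.expGrowth hβ₀ hβ₂
  have hm : Measurable (fracIntegrand β u x) :=
    (measurable_const.sub hg.measurable_heat).div (by fun_prop)
  refine ⟨hm.aestronglyMeasurable, ?_⟩
  calc ∫⁻ t in Ioi (0 : ℝ), ‖fracIntegrand β u x t‖ₑ
      ≤ ∫⁻ t in Ioi (0 : ℝ), ∑' j, ‖jumpIntegrand β u x j t‖ₑ := by
        refine lintegral_mono fun t => ?_
        rw [← (hasSum_jumpIntegrand hg t).tsum_eq]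
        exact enorm_tsum_le_tsum_enorm
    _ = ∑' j, ∫⁻ t in Ioi (0 : ℝ), ‖jumpIntegrand β u x j t‖ₑ :=
        lintegral_tsum fun j =>
          (integrableOn_jumpIntegrand hβ₀ hβ₂ u x j).aestronglyMeasurable.enorm
    _ = ∑' j, ENNReal.ofReal (∫ t in Ioi (0 : ℝ), ‖jumpIntegrand β u x j t‖) :=
        tsum_congr fun j => (ofReal_integral_norm_eq_lintegral_enorm
          (integrableOn_jumpIntegrand hβ₀ hβ₂ u x j)).symm
    _ < ⊤ := (hu.summable_integral_norm hβ₀ hβ₂).tsum_ofReal_lt_top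

lemma Admissible.hasSum_fracLaplacian (hβ₀ : 0 < β) (hβ₂ : β < 2) {x : ℤ} {u : ℤ → ℝ}
    (hu : Admissible 0 (kernel (fracLaplacian β)) x u) :
    HasSum (fun j : ℤ => kernel (fracLaplacian β) j * (u (x + j) - u x))
      (fracLaplacian β u x) := by
  have h : HasSum (fun j => 1 / Real.Gamma (-(β / 2)) *
      ∫ t in Ioi (0 : ℝ), jumpIntegrand β u x j t) (1 / Real.Gamma (-(β / 2)) *
      ∫ t in Ioi (0 : ℝ), ∑' j, jumpIntegrand β u x j t) :=
    (hasSum_integral_of_summable_integral_norm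
      (fun j => integrableOn_jumpIntegrand hβ₀ hβ₂ u x j)
      (hu.summable_integral_norm hβ₀ hβ₂)).mul_left _
  simp_rw [integral_jumpIntegrand,
    fun t => (hasSum_jumpIntegrand (β := β) (hu.expGrowth hβ₀ hβ₂) t).tsum_eq] at h
  exact h

end

/-! ### The Fourier symbol -/

/-- The length of the chord of the unit circle between `1` and `e^{iθ}`. -/
noncomputable def chord (θ : ℝ) : ℝ := ‖Complex.exp (θ * Complex.I) - 1‖

lemma chord_nonneg (θ : ℝ) : 0 ≤ chord θ := norm_nonneg _

lemma chord_sq (θ : ℝ) : chord θ ^ 2 = 2 - 2 * Real.cos θ := by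
  rw [chord, ← Complex.normSq_eq_norm_sq, Complex.normSq_apply]
  simp only [Complex.sub_re, Complex.sub_im, Complex.exp_ofReal_mul_I_re,
    Complex.exp_ofReal_mul_I_im, Complex.one_re, Complex.one_im]
  linear_combination Real.sin_sq_add_cos_sq θ

lemma chord_sub (θ η : ℝ) :
    chord (θ - η) = ‖Complex.exp (θ * Complex.I) - Complex.exp (η * Complex.I)‖ := by
  have h : Complex.exp (θ * Complex.I) - Complex.exp (η * Complex.I) =
      Complex.exp (η * Complex.I) * (Complex.exp ((θ - η : ℝ) * Complex.I) - 1) := by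
    rw [mul_sub, mul_one, ← Complex.exp_add]
    congr 2
    push_cast
    ring
  rw [h, norm_mul, Complex.norm_exp_ofReal_mul_I, one_mul, chord]

lemma chord_sub_le (θ η : ℝ) : chord (θ - η) ≤ chord θ + chord η := by
  rw [chord_sub, chord, chord,
    ← sub_sub_sub_cancel_right (Complex.exp (θ * Complex.I)) (Complex.exp (η * Complex.I)) 1]
  exact norm_sub_le _ _

lemma le_chord_sub (θ η : ℝ) : chord θ - chord η ≤ chord (θ - η) := by
  rw [chord_sub, chord, chord,
    ← sub_sub_sub_cancel_right (Complex.exp (θ * Complex.I)) (Complex.exp (η * Complex.I)) 1]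
  exact norm_sub_norm_le _ _

lemma exists_chord_eq {s : ℝ} (hs₀ : 0 ≤ s) (hs₂ : s ≤ 2) : ∃ θ, chord θ = s := by
  refine ⟨2 * Real.arcsin (s / 2), ?_⟩
  rw [← sq_eq_sq₀ (chord_nonneg _) hs₀, chord_sq, Real.cos_two_mul', Real.cos_sq',
    Real.sin_arcsin (by linarith) (by linarith)]
  ring

lemma admissible_of_bounded {k : ℤ → ℝ} (hk : IsJumpKernel k) {u : ℤ → ℝ} {C : ℝ}
    (hC : ∀ j, |u j| ≤ C) (x : ℤ) : Admissible 0 k x u := by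
  refine ⟨fun _ => ?_, fun h => absurd rfl h⟩
  refine Summable.of_nonneg_of_le (fun j => mul_nonneg (hk.nonneg j) (by positivity)) (fun j => ?_)
    (hk.summable.mul_right C)
  rw [pow_one]
  exact mul_le_mul_of_nonneg_left (hC _) (hk.nonneg j)

/-- The Fourier symbol of `(-Δ)^{β/2}` is proportional to `(2 - 2 cos θ)^{β/2}`: the semigroup
formula diagonalizes on `cos (θ ·)`. The constant is `1`, but its value plays no role. -/
lemma exists_hasSum_symbol {β : ℝ} (hβ₀ : 0 < β) (hβ₂ : β < 2) : ∃ c : ℝ, 0 < c ∧ ∀ θ : ℝ,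
    HasSum (fun j : ℤ => kernel (fracLaplacian β) j * (1 - Real.cos (θ * j)))
      (c * chord θ ^ β) := by
  refine ⟨-(1 / Real.Gamma (-(β / 2))) *
    ∫ t in Ioi (0 : ℝ), (1 - Real.exp (-t)) / t ^ (1 + β / 2),
    mul_pos (neg_one_div_Gamma_pos hβ₀ hβ₂) (integral_one_sub_exp_pos hβ₀ hβ₂), fun θ => ?_⟩
  have h := (Admissible.hasSum_fracLaplacian hβ₀ hβ₂ (admissible_of_bounded
    (isJumpKernel hβ₀ hβ₂) (fun j : ℤ => Real.abs_cos_le_one (θ * j)) 0)).neg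
  have hL : fracLaplacian β (fun j : ℤ => Real.cos (θ * j)) 0 =
      1 / Real.Gamma (-(β / 2)) *
        ∫ t in Ioi (0 : ℝ), (1 - Real.exp (-(chord θ ^ 2) * t)) / t ^ (1 + β / 2) := by
    simp only [fracLaplacian, fracIntegrand, heat_cos, chord_sq]
    simp
  have hpow : (chord θ ^ 2) ^ (β / 2) = chord θ ^ β := by
    rw [← Real.rpow_natCast, ← Real.rpow_mul (chord_nonneg θ)]
    congr 1
    push_cast
    ring
  rw [hL, integral_one_sub_exp hβ₀ (sq_nonneg _), hpow] at h
  rw [neg_mul, neg_mul, mul_assoc, mul_comm _ (chord θ ^ β)]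
  refine h.congr_fun fun j => ?_
  rw [zero_add, Int.cast_zero, mul_zero, Real.cos_zero]
  ring

/-! ### The iterated carré du champ of a trigonometric polynomial -/

lemma hasSum_kernel_mul_one_sub_exp {k : ℤ → ℝ} (hk : IsJumpKernel k) {θ ψ : ℝ}
    (h : HasSum (fun j : ℤ => k j * (1 - Real.cos (θ * j))) ψ) :
    HasSum (fun j : ℤ => (k j : ℂ) * (1 - Complex.exp ((θ * j : ℝ) * Complex.I))) (ψ : ℂ) := by
  have hs : Summable fun j : ℤ => k j * -Real.sin (θ * j) := by
    refine Summable.of_norm_bounded hk.summable fun j => ?_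
    rw [norm_mul, norm_neg, Real.norm_of_nonneg (hk.nonneg j)]
    exact mul_le_of_le_one_right (hk.nonneg j) (Real.abs_sin_le_one _)
  -- The imaginary part is odd in `j`.
  have hodd : ∑' j : ℤ, k j * -Real.sin (θ * j) = 0 := by
    have h1 := (Equiv.neg ℤ).tsum_eq fun j : ℤ => k j * -Real.sin (θ * j)
    have h2 : ∀ j : ℤ, k (Equiv.neg ℤ j) * -Real.sin (θ * (Equiv.neg ℤ j : ℤ)) =
        -(k j * -Real.sin (θ * j)) := fun j => by
      rw [Equiv.neg_apply, hk.symm, Int.cast_neg, mul_neg θ, Real.sin_neg, mul_neg (k j)]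
    rw [tsum_congr h2, tsum_neg] at h1
    linarith
  have hi := hs.hasSum
  rw [hodd] at hi
  rw [Complex.hasSum_iff, Complex.ofReal_re, Complex.ofReal_im]
  constructor
  · convert h using 2 with j
    rw [Complex.re_ofReal_mul, Complex.sub_re, Complex.one_re, Complex.exp_ofReal_mul_I_re]
  · convert hi using 2 with j
    rw [Complex.im_ofReal_mul, Complex.sub_im, Complex.one_im, Complex.exp_ofReal_mul_I_im,
      zero_sub]

/-- The increment `e^{iθj} - 1`. The second difference of `e^{iθ·}` is multiplicative in it:
`e^{iθ(j+l)} - e^{iθj} - e^{iθl} + 1 = (e^{iθj} - 1) (e^{iθl} - 1)`. -/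
noncomputable def expIncr (θ : ℝ) (j : ℤ) : ℂ := Complex.exp ((θ * j : ℝ) * Complex.I) - 1

lemma re_expIncr_mul (θ : ℝ) (j l : ℤ) : (expIncr θ j * expIncr θ l).re =
    Real.cos (θ * (j + l : ℤ)) - Real.cos (θ * j) - Real.cos (θ * l) + 1 := by
  have h : expIncr θ j * expIncr θ l = Complex.exp ((θ * (j + l : ℤ) : ℝ) * Complex.I) -
      Complex.exp ((θ * j : ℝ) * Complex.I) - Complex.exp ((θ * l : ℝ) * Complex.I) + 1 := by
    have : ((θ * (j + l : ℤ) : ℝ) : ℂ) * Complex.I =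
        (θ * j : ℝ) * Complex.I + (θ * l : ℝ) * Complex.I := by
      push_cast
      ring
    rw [this, Complex.exp_add, expIncr, expIncr]
    ring
  rw [h]
  simp only [Complex.add_re, Complex.sub_re, Complex.exp_ofReal_mul_I_re, Complex.one_re]

lemma hasSum_kernel_mul_expIncr {k : ℤ → ℝ} (hk : IsJumpKernel k) {ψ : ℝ → ℝ}
    (hψ : ∀ θ, HasSum (fun j : ℤ => k j * (1 - Real.cos (θ * j))) (ψ θ)) (θ η : ℝ) :
    HasSum (fun j : ℤ => (k j : ℂ) * (expIncr θ j * (starRingEnd ℂ) (expIncr η j)))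
      ((ψ θ + ψ η - ψ (θ - η) : ℝ) : ℂ) := by
  have hη : ψ (-η) = ψ η := by
    refine (hψ (-η)).unique ?_
    simpa only [neg_mul, Real.cos_neg] using hψ η
  have h := ((hasSum_kernel_mul_one_sub_exp hk (hψ θ)).add
    (hasSum_kernel_mul_one_sub_exp hk (hψ (-η)))).sub
    (hasSum_kernel_mul_one_sub_exp hk (hψ (θ - η)))
  rw [hη, ← Complex.ofReal_add, ← Complex.ofReal_sub] at h
  refine h.congr_fun fun j => ?_
  have h1 : (starRingEnd ℂ) (Complex.exp ((η * j : ℝ) * Complex.I)) =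
      Complex.exp ((-η * j : ℝ) * Complex.I) := by
    rw [← Complex.exp_conj, map_mul, Complex.conj_ofReal, Complex.conj_I]
    congr 1
    push_cast
    ring
  have h2 : Complex.exp (((θ - η) * j : ℝ) * Complex.I) =
      Complex.exp ((θ * j : ℝ) * Complex.I) * Complex.exp ((-η * j : ℝ) * Complex.I) := by
    rw [← Complex.exp_add]
    congr 1
    push_cast
    ring
  rw [expIncr, expIncr, map_sub, map_one, h1, h2]
  ring

/-- For `u = ∑ᵢ aᵢ cos (θᵢ ·)` the double sum in `Γ₂(u)(0)` factorizes, once `u` is replaced by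
`∑ᵢ aᵢ e^{iθᵢ·}`, of which it is the real part. -/
lemma carreDuChamp₂_cos_le {k : ℤ → ℝ} (hk : IsJumpKernel k) {ψ : ℝ → ℝ}
    (hψ : ∀ θ, HasSum (fun j : ℤ => k j * (1 - Real.cos (θ * j))) (ψ θ))
    {ι : Type*} (s : Finset ι) (a θ : ι → ℝ) :
    carreDuChamp₂ k (fun j : ℤ => ∑ i ∈ s, a i * Real.cos (θ i * j)) 0 ≤ ENNReal.ofReal
      (1 / 4 * ∑ i ∈ s, ∑ i' ∈ s, a i * a i' * (ψ (θ i) + ψ (θ i') - ψ (θ i - θ i')) ^ 2) := by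
  set F : ℤ × ℤ → ℝ := fun p => k p.1 * k p.2 *
    Complex.normSq (∑ i ∈ s, (a i : ℂ) * (expIncr (θ i) p.1 * expIncr (θ i) p.2)) with hF
  set h : ι → ι → ℤ → ℂ := fun i i' j =>
    (k j : ℂ) * (expIncr (θ i) j * (starRingEnd ℂ) (expIncr (θ i') j)) with hh
  have hh_sum : ∀ i i', HasSum (h i i') ((ψ (θ i) + ψ (θ i') - ψ (θ i - θ i') : ℝ) : ℂ) :=
    fun i i' => hasSum_kernel_mul_expIncr hk hψ (θ i) (θ i')
  have hexpand : ∀ p, ((F p : ℝ) : ℂ) = ∑ i ∈ s, ∑ i' ∈ s,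
      ((a i : ℂ) * a i') * (h i i' p.1 * h i i' p.2) := by
    intro p
    rw [hF]
    push_cast
    rw [← Complex.mul_conj, map_sum, Finset.sum_mul_sum, Finset.mul_sum]
    refine Finset.sum_congr rfl fun i _ => ?_
    rw [Finset.mul_sum]
    refine Finset.sum_congr rfl fun i' _ => ?_
    simp only [map_mul, Complex.conj_ofReal, hh]
    ring
  have hF_sum : HasSum F (∑ i ∈ s, ∑ i' ∈ s,
      a i * a i' * (ψ (θ i) + ψ (θ i') - ψ (θ i - θ i')) ^ 2) := by
    rw [← Complex.hasSum_ofReal]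
    simp_rw [hexpand]
    push_cast
    refine hasSum_sum fun i _ => hasSum_sum fun i' _ => HasSum.mul_left _ ?_
    have h1 := (hh_sum i i').mul (hh_sum i i')
      (summable_mul_of_summable_norm (hh_sum i i').summable.norm (hh_sum i i').summable.norm)
    push_cast at h1
    rwa [← sq] at h1
  have hF_nonneg : ∀ p, 0 ≤ F p := fun p =>
    mul_nonneg (mul_nonneg (hk.nonneg _) (hk.nonneg _)) (Complex.normSq_nonneg _)
  rw [ENNReal.ofReal_mul (by norm_num), ← hF_sum.tsum_eq,
    ENNReal.ofReal_tsum_of_nonneg hF_nonneg hF_sum.summable, carreDuChamp₂]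
  refine mul_le_mul' ?_ (ENNReal.tsum_le_tsum fun p => ENNReal.ofReal_le_ofReal ?_)
  · rw [ENNReal.ofReal_div_of_pos (by norm_num)]
    simp
  · refine mul_le_mul_of_nonneg_left ?_ (mul_nonneg (hk.nonneg _) (hk.nonneg _))
    have hre : (∑ i ∈ s, a i * Real.cos (θ i * (0 + p.1 + p.2 : ℤ))) -
        (∑ i ∈ s, a i * Real.cos (θ i * (0 + p.1 : ℤ))) -
        (∑ i ∈ s, a i * Real.cos (θ i * (0 + p.2 : ℤ))) +
        (∑ i ∈ s, a i * Real.cos (θ i * (0 : ℤ))) =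
        (∑ i ∈ s, (a i : ℂ) * (expIncr (θ i) p.1 * expIncr (θ i) p.2)).re := by
      rw [Complex.re_sum, ← Finset.sum_sub_distrib, ← Finset.sum_sub_distrib,
        ← Finset.sum_add_distrib]
      refine Finset.sum_congr rfl fun i _ => ?_
      rw [Complex.re_ofReal_mul, re_expIncr_mul]
      simp only [zero_add, Int.cast_zero, mul_zero, Real.cos_zero]
      ring
    rw [hre, sq]
    exact Complex.re_sq_le_normSq _

/-! ### Failure of the curvature-dimension inequality -/

/-- Two frequencies of very different size barely interact: the interaction of the powers `s ^ β`
and `s' ^ β`, normalized, decays like a positive power of `s' / s`. The exponent is positive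
exactly because `0 < β < 2`. -/
lemma interaction_le_of_le {β s s' m : ℝ} (hβ₀ : 0 < β) (hβ₂ : β < 2) (hs' : 0 < s')
    (hss' : s' ≤ s) (hm₁ : s - s' ≤ m) (hm₂ : m ≤ s + s') :
    (s ^ β + s' ^ β - m ^ β) ^ 2 ≤ 16 * (s ^ β * s' ^ β) * (s' / s) ^ min β (2 - β) := by
  have hs : 0 < s := hs'.trans_le hss'
  obtain ⟨r, rfl⟩ : ∃ r, s' = s * r := ⟨s' / s, by field_simp⟩
  obtain ⟨μ, rfl⟩ : ∃ μ, m = s * μ := ⟨m / s, by field_simp⟩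
  have hr₀ : 0 < r := pos_of_mul_pos_right hs' hs.le
  have hr₁ : r ≤ 1 := by nlinarith
  have hμ₁ : 1 - r ≤ μ := by nlinarith
  have hμ₂ : μ ≤ 1 + r := by nlinarith
  have hμ₀ : 0 ≤ μ := by linarith
  rw [mul_div_cancel_left₀ _ hs.ne', Real.mul_rpow hs.le hr₀.le, Real.mul_rpow hs.le hμ₀]
  have h1 : μ ^ β ≤ 1 + 3 * r := by
    calc μ ^ β ≤ (1 + r) ^ β := by gcongr
      _ ≤ (1 + r) ^ (2 : ℝ) := Real.rpow_le_rpow_of_exponent_le (by linarith) hβ₂.le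
      _ = (1 + r) ^ 2 := by exact_mod_cast Real.rpow_natCast (1 + r) 2
      _ ≤ 1 + 3 * r := by nlinarith
  have h2 : 1 - 2 * r ≤ μ ^ β := by
    calc 1 - 2 * r ≤ (1 - r) ^ 2 := by nlinarith
      _ = (1 - r) ^ (2 : ℝ) := by exact_mod_cast (Real.rpow_natCast (1 - r) 2).symm
      _ ≤ (1 - r) ^ β := Real.rpow_le_rpow_of_exponent_ge' (by linarith) (by linarith) hβ₀.le
          hβ₂.le
      _ ≤ μ ^ β := Real.rpow_le_rpow (by linarith) hμ₁ hβ₀.le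
  have h3 : r ≤ r ^ min β 1 := by
    conv_lhs => rw [← Real.rpow_one r]
    exact Real.rpow_le_rpow_of_exponent_ge hr₀ hr₁ (min_le_right _ _)
  have h4 : r ^ β ≤ r ^ min β 1 :=
    Real.rpow_le_rpow_of_exponent_ge hr₀ hr₁ (min_le_left _ _)
  have h5 : 0 < r ^ β := by positivity
  have h6 : (1 + r ^ β - μ ^ β) ^ 2 ≤ (4 * r ^ min β 1) ^ 2 := by
    rw [sq_le_sq, abs_of_nonneg (a := 4 * r ^ min β 1) (by positivity), abs_le]
    constructor <;> linarith
  have h7 : (r ^ min β 1) ^ 2 = r ^ β * r ^ min β (2 - β) := by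
    rw [← Real.rpow_natCast, ← Real.rpow_mul hr₀.le, ← Real.rpow_add hr₀]
    congr 1
    push_cast
    rcases le_total β 1 with h | h
    · rw [min_eq_left h, min_eq_left (by linarith)]
      ring
    · rw [min_eq_right h, min_eq_right (by linarith)]
      ring
  calc (s ^ β + s ^ β * r ^ β - s ^ β * μ ^ β) ^ 2
      = (s ^ β) ^ 2 * (1 + r ^ β - μ ^ β) ^ 2 := by ring
    _ ≤ (s ^ β) ^ 2 * (4 * r ^ min β 1) ^ 2 := by gcongr
    _ = (s ^ β) ^ 2 * (16 * (r ^ min β 1) ^ 2) := by ring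
    _ = _ := by rw [h7]; ring

/-- `N` frequencies so far apart that the total interaction is of the order `N` of the diagonal
terms alone. -/
lemma exists_lacunary {β : ℝ} (hβ₀ : 0 < β) (hβ₂ : β < 2) {N : ℕ} (hN : N ≠ 0) :
    ∃ θ : ℕ → ℝ, (∀ i, 0 < chord (θ i)) ∧ ∀ i i' : ℕ,
      (chord (θ i) ^ β + chord (θ i') ^ β - chord (θ i - θ i') ^ β) ^ 2 ≤
        16 * (chord (θ i) ^ β * chord (θ i') ^ β) *
          ((if i = i' then 1 else 0) + (N : ℝ)⁻¹) := by
  set δ := min β (2 - β)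
  have hδ : 0 < δ := lt_min hβ₀ (by linarith)
  have hN₁ : (1 : ℝ) ≤ N := by exact_mod_cast Nat.one_le_iff_ne_zero.2 hN
  -- The ratio of consecutive chords is chosen with `q ^ δ = 1 / N`.
  set q : ℝ := (N : ℝ)⁻¹ ^ δ⁻¹
  have hq₀ : 0 < q := by positivity
  have hq₁ : q ≤ 1 := Real.rpow_le_one (by positivity) (inv_le_one_of_one_le₀ hN₁) (by positivity)
  have hqδ : q ^ δ = (N : ℝ)⁻¹ := Real.rpow_inv_rpow (by positivity) hδ.ne'
  choose θ hθ using fun i : ℕ => exists_chord_eq (s := q ^ i) (by positivity)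
    ((pow_le_one₀ hq₀.le hq₁).trans one_le_two)
  have hpos : ∀ i, 0 < chord (θ i) := fun i => by rw [hθ]; positivity
  have hle : ∀ i i' : ℕ, i ≤ i' →
      (chord (θ i) ^ β + chord (θ i') ^ β - chord (θ i - θ i') ^ β) ^ 2 ≤
        16 * (chord (θ i) ^ β * chord (θ i') ^ β) *
          ((if i = i' then 1 else 0) + (N : ℝ)⁻¹) := by
    intro i i' hii'
    have hle' : chord (θ i') ≤ chord (θ i) := by
      rw [hθ, hθ]
      exact pow_le_pow_of_le_one hq₀.le hq₁ hii'
    refine (interaction_le_of_le hβ₀ hβ₂ (hpos i') hle' (le_chord_sub _ _)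
      (chord_sub_le _ _)).trans ?_
    have h1 := hpos i
    have h2 := hpos i'
    refine mul_le_mul_of_nonneg_left ?_ (by positivity)
    split_ifs with h
    · rw [h, div_self h2.ne', Real.one_rpow]
      exact le_add_of_nonneg_right (by positivity)
    · rw [zero_add, ← hqδ]
      refine Real.rpow_le_rpow (by positivity) ?_ hδ.le
      rw [div_le_iff₀ h1, hθ, hθ, ← pow_succ']
      exact pow_le_pow_of_le_one hq₀.le hq₁ (by omega)
  refine ⟨θ, hpos, fun i i' => ?_⟩
  rcases le_total i i' with h | h
  · exact hle i i' h
  · have h1 := hle i' i h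
    have h2 : chord (θ i - θ i') = chord (θ i' - θ i) := by
      rw [chord_sub, chord_sub, norm_sub_rev]
    rw [h2, add_comm (chord (θ i) ^ β), mul_comm (chord (θ i) ^ β)]
    simpa only [eq_comm] using h1

/-- The test function `∑ᵢ cos (θᵢ ·) / ψ (θᵢ)`, with `N` lacunary frequencies `θᵢ` and `ψ` the
symbol: `(L u)²` grows like `N²`, but `Γ₂(u)` only like `N`. -/
lemma exists_test_function {β : ℝ} (hβ₀ : 0 < β) (hβ₂ : β < 2) {N : ℕ} (hN : N ≠ 0) :
    ∃ u : ℤ → ℝ, Admissible 0 (kernel (fracLaplacian β)) 0 u ∧ fracLaplacian β u 0 = -N ∧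
      carreDuChamp₂ (kernel (fracLaplacian β)) u 0 ≤ ENNReal.ofReal (8 * N) := by
  have hk := isJumpKernel hβ₀ hβ₂
  obtain ⟨c, hc, hψ⟩ := exists_hasSum_symbol hβ₀ hβ₂
  obtain ⟨θ, hθ, hint⟩ := exists_lacunary hβ₀ hβ₂ hN
  have hpos : ∀ i, 0 < chord (θ i) ^ β := fun i => Real.rpow_pos_of_pos (hθ i) β
  set a : ℕ → ℝ := fun i => (c * chord (θ i) ^ β)⁻¹ with ha
  have hadm : Admissible 0 (kernel (fracLaplacian β)) 0
      fun j : ℤ => ∑ i ∈ Finset.range N, a i * Real.cos (θ i * j) := by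
    refine admissible_of_bounded hk (C := ∑ i ∈ Finset.range N, |a i|) (fun j => ?_) 0
    refine (Finset.abs_sum_le_sum_abs _ _).trans (Finset.sum_le_sum fun i _ => ?_)
    rw [abs_mul]
    exact mul_le_of_le_one_right (abs_nonneg _) (Real.abs_cos_le_one _)
  refine ⟨_, hadm, ?_, (carreDuChamp₂_cos_le hk hψ (Finset.range N) a θ).trans
    (ENNReal.ofReal_le_ofReal ?_)⟩
  · refine (hadm.hasSum_fracLaplacian hβ₀ hβ₂).unique ?_
    have h := (hasSum_sum fun i (_ : i ∈ Finset.range N) => (hψ (θ i)).mul_left (a i)).neg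
    have h1 : ∀ i ∈ Finset.range N, a i * (c * chord (θ i) ^ β) = 1 := fun i _ =>
      inv_mul_cancel₀ (mul_pos hc (hpos i)).ne'
    rw [Finset.sum_congr rfl h1, Finset.sum_const, Finset.card_range, nsmul_one] at h
    refine h.congr_fun fun j => ?_
    rw [← Finset.sum_sub_distrib, Finset.mul_sum, ← Finset.sum_neg_distrib]
    refine Finset.sum_congr rfl fun i _ => ?_
    simp
    ring
  · have hterm : ∀ i i' : ℕ, a i * a i' * (c * chord (θ i) ^ β + c * chord (θ i') ^ β -
        c * chord (θ i - θ i') ^ β) ^ 2 ≤ 16 * ((if i = i' then 1 else 0) + (N : ℝ)⁻¹) := by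
      intro i i'
      have h1 := hpos i
      have h2 := hpos i'
      have h3 : a i * a i' * (c * chord (θ i) ^ β + c * chord (θ i') ^ β -
          c * chord (θ i - θ i') ^ β) ^ 2 =
          (chord (θ i) ^ β + chord (θ i') ^ β - chord (θ i - θ i') ^ β) ^ 2 /
            (chord (θ i) ^ β * chord (θ i') ^ β) := by
        rw [ha]
        field_simp
      rw [h3, div_le_iff₀ (by positivity)]
      exact (hint i i').trans_eq (by ring)
    have hN₀ : (N : ℝ) ≠ 0 := by exact_mod_cast hN
    calc _ ≤ 1 / 4 * ∑ i ∈ Finset.range N, ∑ i' ∈ Finset.range N,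
          16 * ((if i = i' then 1 else 0) + (N : ℝ)⁻¹) := by
          refine mul_le_mul_of_nonneg_left ?_ (by norm_num)
          exact Finset.sum_le_sum fun i _ => Finset.sum_le_sum fun i' _ => hterm i i'
      _ = 1 / 4 * ∑ i ∈ Finset.range N, 32 := by
          congr 1
          refine Finset.sum_congr rfl fun i hi => ?_
          rw [← Finset.mul_sum, Finset.sum_add_distrib, Finset.sum_ite_eq, if_pos hi,
            Finset.sum_const, Finset.card_range, nsmul_eq_mul, mul_inv_cancel₀ hN₀]
          norm_num
      _ = 8 * N := by
          rw [Finset.sum_const, Finset.card_range, nsmul_eq_mul]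
          ring

lemma not_CD_fracLaplacian {β : ℝ} (hβ₀ : 0 < β) (hβ₂ : β < 2) {d : ℝ} (hd : 0 < d) :
    ¬ CD (fracLaplacian β) 0 d := by
  intro h
  obtain ⟨N, hN⟩ := exists_nat_gt (8 * d)
  have hN₀ : (0 : ℝ) < N := by linarith
  obtain ⟨u, hu, hLu, hΓ⟩ := exists_test_function hβ₀ hβ₂ (N := N) (by exact_mod_cast hN₀.ne')
  have h1 := (h 0 u hu).trans (EReal.coe_ennreal_le_coe_ennreal_iff.2 hΓ)
  rw [hLu, EReal.coe_ennreal_ofReal, EReal.coe_le_coe_iff, max_eq_left (by positivity), zero_mul,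
    add_zero, one_div, inv_mul_le_iff₀ hd] at h1
  nlinarith

end LatticeCD

/-- For `0 < β < 2` the operator `-(-Δ)^{β/2}` on `ℤ` is well defined on the admissible functions
and is there the operator of a jump kernel, and it fails `CD(0, d)` for every finite `d > 0`. -/
theorem mainTheorem9 (β : ℝ) (hβ₀ : 0 < β) (hβ₂ : β < 2) :
    LatticeCD.IsJumpKernel (LatticeCD.kernel (LatticeCD.fracLaplacian β)) ∧
    (∀ (x : ℤ) (u : ℤ → ℝ),
      LatticeCD.Admissible 0 (LatticeCD.kernel (LatticeCD.fracLaplacian β)) x u →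
        (∀ t : ℝ, Summable fun n : ℕ =>
          t ^ n / (n.factorial : ℝ) * (LatticeCD.laplacian^[n] u) x) ∧
        IntegrableOn (LatticeCD.fracIntegrand β u x) (Ioi 0) ∧
        HasSum (fun j : ℤ => LatticeCD.kernel (LatticeCD.fracLaplacian β) j * (u (x + j) - u x))
          (LatticeCD.fracLaplacian β u x)) ∧
    ∀ d : ℝ, 0 < d → ¬ LatticeCD.CD (LatticeCD.fracLaplacian β) 0 d :=
  ⟨LatticeCD.isJumpKernel hβ₀ hβ₂, fun _ _ hu =>
    ⟨fun t => ((hu.expGrowth hβ₀ hβ₂).hasSum_heat t).summable,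
      hu.integrableOn_fracIntegrand hβ₀ hβ₂, hu.hasSum_fracLaplacian hβ₀ hβ₂⟩,
    fun _ hd => LatticeCD.not_CD_fracLaplacian hβ₀ hβ₂ hd⟩
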